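/- **Theorem (Markov).** Let $\mathcal P=\mathbb C[x]$ and let $\mathbf u:\mathcal P\to\mathbb C$ be a linear functional that is positive-definite, i.e. $\langle \mathbf u,p\rangle>0$ for every nonzero polynomial $p$ with $p(x)\ge 0$ for all real $x$. Write $u_0=\langle\mathbf u,1\rangle$, and let $\{P_n\}_{n\ge0}$ be the monic orthogonal polynomial sequence with respect to $\mathbf u$ (that is, $P_n$ is monic of degree $n$, $\langle\mathbf u,P_mP_n\rangle=0$ for $m\ne n$ and $\langle\mathbf u,P_n^2\rangle\neq0$). The zeros $x_{n,1}<\dots<x_{n,n}$ of $P_n$ are real and simple. Put $$\beta_n=\frac{\langle\mathbf u,xP_n^2\rangle}{\langle\mathbf u,P_n^2\rangle}\ (n\ge0),\qquad \gamma_n=\frac{\langle\mathbf u,P_n^2\rangle}{\langle\mathbf u,P_{n-1}^2\rangle}\ (n\ge1),$$ the coefficients of the recurrence $P_{n+1}=(x-\beta_n)P_n-\gamma_nP_{n-1}$, and let $\{P^{(1)}_n\}_{n\ge0}$ be the associated polynomials of the first kind: $$P^{(1)}_{n+1}(x)=(x-\beta_{n+1})P^{(1)}_n(x)-\gamma_{n+1}P^{(1)}_{n-1}(x),\qquad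 P^{(1)}_{-1}=0,\ P^{(1)}_0=1.$$ For $n\ge1$ let $A_{n,j}=\Big\langle\mathbf u,\frac{P_n(x)}{(x-x_{n,j})P_n'(x_{n,j})}\Big\rangle>0$ be the weights of the Gauss–Jacobi–Christoffel quadrature formula, and let $\psi_n(x)=\sum_{j:\,x_{n,j}\le x}A_{n,j}$ for $x\in\mathbb R$. A natural representative of $\mathbf u$ is a function $\psi:\mathbb R\to\mathbb R$ which is the pointwise limit on $\mathbb R$ of a subsequence of $\{\psi_n\}$; such a $\psi$ is nondecreasing, and its spectrum is $\sigma(\psi)=\{x\in\mathbb R:\psi(x+\delta)-\psi(x-\delta)>0\text{ for all }\delta>0\}$. Let $$Z_1=\{x_{n,j}:1\le j\le n,\ n\in\mathbb N\},\quad X_1=\{\text{accumulation points of }Z_1\},\quad X_2=\{x\in Z_1:P_n(x)=0\text{ for infinitely many }n\}.$$ Let $\psi$ be a natural representative of $\mathbf u$ and assume that $\sigma(\psi)$ is bounded. Then $$\lim_{n\to\infty}\frac{u_0P^{(1)}_{n-1}(z)}{P_n(z)}=\int_{-\infty}^{+\infty}\frac{d\psi(x)}{z-x},\qquad z\in\mathbb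 C\setminus(X_1\cup X_2),$$ where the integral with respect to the Lebesgue–Stieltjes measure $d\psi$ is absolutely convergent, and the convergence is uniform on compact subsets of $\mathbb C\setminus(X_1\cup X_2)$ (on each such compact set $P_n$ has no zero for all sufficiently large $n$, so the quotients are defined there from some $n$ on). -/

import Mathlib

open Polynomial Filter Topology MeasureTheory

namespace OPS

/-- `u` is positive-definite: `⟨u, p⟩ > 0` for every nonzero polynomial `p` that is (real and)
nonnegative at all real points. -/
def IsPosDef (u : ℂ[X] →ₗ[ℂ] ℂ) : Prop :=
  ∀ p : ℂ[X], p ≠ 0 → (∀ x : ℝ, 0 ≤ (p.eval (x : ℂ)).re ∧ (p.eval (x : ℂ)).im = 0) →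
    0 < (u p).re ∧ (u p).im = 0

/-- `P` is the monic orthogonal polynomial sequence with respect to `u`. -/
structure IsMonicOPS (u : ℂ[X] →ₗ[ℂ] ℂ) (P : ℕ → ℂ[X]) : Prop where
  monic : ∀ n, (P n).Monic
  natDegree_eq : ∀ n, (P n).natDegree = n
  orthogonal : ∀ m n, m ≠ n → u (P m * P n) = 0
  norm_ne_zero : ∀ n, u (P n * P n) ≠ 0

/-- The coefficient `β n` of the recurrence `P (n+1) = (X - β n) P n - γ n P (n-1)`. -/
noncomputable def beta (u : ℂ[X] →ₗ[ℂ] ℂ) (P : ℕ → ℂ[X]) (n : ℕ) : ℂ :=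
  u (X * P n ^ 2) / u (P n ^ 2)

/-- The coefficient `γ n` of the recurrence `P (n+1) = (X - β n) P n - γ n P (n-1)`, `n ≥ 1`
(the value `γ 0 = ⟨u, 1⟩` is a convention that plays no role). -/
noncomputable def gamma (u : ℂ[X] →ₗ[ℂ] ℂ) (P : ℕ → ℂ[X]) : ℕ → ℂ
  | 0 => u 1
  | n + 1 => u (P (n + 1) ^ 2) / u (P n ^ 2)

/-- The monic associated polynomials of order `k`, from the recurrence with coefficients shifted
by `k`:
`Q (n+1) = (X - β (n+k)) Q n - γ (n+k) Q (n-1)`, `Q (-1) = 0`, `Q 0 = 1`. -/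
noncomputable def associated (u : ℂ[X] →ₗ[ℂ] ℂ) (P : ℕ → ℂ[X]) (k : ℕ) : ℕ → ℂ[X]
  | 0 => 1
  | 1 => X - C (beta u P k)
  | n + 2 => (X - C (beta u P (n + 1 + k))) * associated u P k (n + 1)
      - C (gamma u P (n + 1 + k)) * associated u P k n

/-- The weight `⟨u, p(x) / ((x - r) p'(r))⟩` of the Gauss–Jacobi–Christoffel quadrature formula
with nodes at the zeros of `p`, at the node `r`. -/
noncomputable def gaussWeight (u : ℂ[X] →ₗ[ℂ] ℂ) (p : ℂ[X]) (r : ℂ) : ℂ :=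
  u (C (p.derivative.eval r)⁻¹ * (p /ₘ (X - C r)))

open Classical in
/-- The right-continuous step function `ψ_n` that vanishes at `-∞` and jumps by the quadrature
weight at each zero of `p = P n`. For a positive-definite `u` the zeros of `P n` and the weights
are real, so that the real parts only transport them from `ℂ` to `ℝ`. -/
noncomputable def stepDist (u : ℂ[X] →ₗ[ℂ] ℂ) (p : ℂ[X]) (x : ℝ) : ℝ :=
  ∑ r ∈ p.roots.toFinset with r.re ≤ x, (gaussWeight u p r).re

/-- `ψ` is a natural representative of `u`: the pointwise limit on `ℝ` of a subsequence of the
step functions `ψ_n`. -/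
def IsNaturalRepresentative (u : ℂ[X] →ₗ[ℂ] ℂ) (P : ℕ → ℂ[X]) (ψ : ℝ → ℝ) : Prop :=
  ∃ φ : ℕ → ℕ, StrictMono φ ∧
    ∀ x : ℝ, Tendsto (fun j => stepDist u (P (φ j)) x) atTop (𝓝 (ψ x))

/-- The spectrum `σ(ψ)`: the points of increase of `ψ`. -/
def spectrum (ψ : ℝ → ℝ) : Set ℝ :=
  {x | ∀ δ > 0, 0 < ψ (x + δ) - ψ (x - δ)}

/-- The set `Z₁` of all zeros of the polynomials `P n`, `n ≥ 1`. -/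
def zeroSet (P : ℕ → ℂ[X]) : Set ℂ :=
  {z | ∃ n, 1 ≤ n ∧ (P n).eval z = 0}

/-- `X₁`: the accumulation points of the set of all zeros. -/
def accZeros (P : ℕ → ℂ[X]) : Set ℂ := derivedSet (zeroSet P)

/-- `X₂`: the points that are zeros of `P n` for infinitely many `n`. -/
def recZeros (P : ℕ → ℂ[X]) : Set ℂ :=
  {z | z ∈ zeroSet P ∧ {n : ℕ | (P n).eval z = 0}.Infinite}

end OPS

/-! The quotient at index `n` is the Cauchy transform of the discrete Gauss measure carried by the
zeros of `P n` (`IsMonicOPS.quotient_eq`), so the theorem compares this transform with that of the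
Stieltjes measure `ν` of `ψ`.

Both measures integrate polynomials to the same value: Gauss quadrature is exact below degree `2 *
n` (`IsMonicOPS.quadrature`), and `ν`, supported in some `[-R, R]`, represents `u` on all
polynomials (`IsNaturalRepresentative.u_X_pow`, `map_eq_integral`). All zeros then lie in `[-R, R]`
as well (`IsMonicOPS.root_mem_Icc`). A point outside `X₁ ∪ X₂` has a disc that contains no zero of
`P n` for large `n` (`exists_ball_zero_free`), and `ν` does not charge that disc either
(`IsNaturalRepresentative.ae_le_norm_sub`). On the rest of `[-R, R]` the Cauchy kernel is a uniform
limit of polynomials, whose integrals agree once `n` is large; only the approximation error times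
the total mass remains (`IsMonicOPS.exists_ball_dist_lt`).

The subsequence defining `ψ` enters only through the properties of `ν`, so the whole sequence of
quotients converges. -/

namespace OPS

/-! ### Positivity of `u` on products of a polynomial with its conjugate -/

/-- The polynomial with conjugated coefficients. -/
noncomputable def conjPoly (q : ℂ[X]) : ℂ[X] := q.map (starRingEnd ℂ)

lemma conjPoly_ne_zero {q : ℂ[X]} (hq : q ≠ 0) : conjPoly q ≠ 0 :=
  (Polynomial.map_ne_zero_iff (starRingEnd ℂ).injective).2 hq

lemma degree_conjPoly (q : ℂ[X]) : (conjPoly q).degree = q.degree := degree_map _ _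

lemma eval_conjPoly (q : ℂ[X]) (x : ℝ) :
    (conjPoly q).eval (x : ℂ) = starRingEnd ℂ (q.eval (x : ℂ)) := by
  have := hom_eval₂ q (RingHom.id ℂ) (starRingEnd ℂ) (x : ℂ)
  rw [RingHom.comp_id, Complex.conj_ofReal, eval₂_id] at this
  rw [conjPoly, eval_map, this]

lemma eval_mul_conjPoly (q : ℂ[X]) (x : ℝ) :
    (q * conjPoly q).eval (x : ℂ) = ((‖q.eval (x : ℂ)‖ ^ 2 : ℝ) : ℂ) := by
  rw [eval_mul, eval_conjPoly, Complex.mul_conj, Complex.normSq_eq_norm_sq]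

variable {u : ℂ[X] →ₗ[ℂ] ℂ} {P : ℕ → ℂ[X]}

lemma map_C_mul (L : ℂ[X] →ₗ[ℂ] ℂ) (c : ℂ) (p : ℂ[X]) : L (C c * p) = c * L p := by
  rw [C_mul', map_smul, smul_eq_mul]

/-- Positivity of `u`, tested on polynomials with given nonnegative real values. -/
lemma IsPosDef.pos_of_eval_eq (hu : IsPosDef u) {p : ℂ[X]} (hp : p ≠ 0) (f : ℝ → ℝ)
    (hf : ∀ x, 0 ≤ f x) (h : ∀ x : ℝ, p.eval (x : ℂ) = (f x : ℂ)) :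
    0 < (u p).re ∧ (u p).im = 0 :=
  hu p hp fun x => by rw [h x]; exact ⟨by simpa using hf x, by simp⟩

lemma IsPosDef.mul_conj (hu : IsPosDef u) {q : ℂ[X]} (hq : q ≠ 0) :
    0 < (u (q * conjPoly q)).re ∧ (u (q * conjPoly q)).im = 0 :=
  hu.pos_of_eval_eq (mul_ne_zero hq (conjPoly_ne_zero hq)) _ (fun _ => sq_nonneg _)
    (eval_mul_conjPoly q)

lemma IsPosDef.sq_mul_conj (hu : IsPosDef u) {q : ℂ[X]} (hq : q ≠ 0) (c : ℝ) :
    0 < (u ((X - C (c : ℂ)) ^ 2 * (q * conjPoly q))).re ∧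
      (u ((X - C (c : ℂ)) ^ 2 * (q * conjPoly q))).im = 0 := by
  refine hu.pos_of_eval_eq (mul_ne_zero (pow_ne_zero _ (X_sub_C_ne_zero _))
    (mul_ne_zero hq (conjPoly_ne_zero hq))) (fun x => (x - c) ^ 2 * ‖q.eval (x : ℂ)‖ ^ 2)
    (fun x => by positivity) fun x => ?_
  rw [eval_mul, eval_mul_conjPoly]
  simp

/-- `X` changes sign, so positivity does not apply directly; polarization `4X = (X + 1)² - (X - 1)²`
reduces to squares. -/
lemma IsPosDef.im_X_mul_conj (hu : IsPosDef u) {q : ℂ[X]} (hq : q ≠ 0) :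
    (u (X * (q * conjPoly q))).im = 0 := by
  have h1 := (hu.sq_mul_conj hq 1).2
  have h2 := (hu.sq_mul_conj hq (-1)).2
  have h3 : u (X * (q * conjPoly q)) = (4 : ℂ)⁻¹ *
      (u ((X - C ((-1 : ℝ) : ℂ)) ^ 2 * (q * conjPoly q)) -
        u ((X - C ((1 : ℝ) : ℂ)) ^ 2 * (q * conjPoly q))) := by
    rw [← map_sub, ← map_C_mul]
    congr 1
    have : (C (4 : ℂ)⁻¹ : ℂ[X]) * 4 = 1 := by
      rw [show (4 : ℂ[X]) = C (4 : ℂ) from rfl, ← C_mul]; norm_num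
    simp only [Complex.ofReal_neg, Complex.ofReal_one, map_neg, C_1]
    linear_combination -(X * (q * conjPoly q)) * this
  rw [h3, show (4 : ℂ)⁻¹ = (((4 : ℝ)⁻¹ : ℝ) : ℂ) by push_cast; rfl, Complex.im_ofReal_mul,
    Complex.sub_im, h1, h2]
  simp

lemma IsPosDef.one_re_pos (hu : IsPosDef u) : 0 < (u 1).re :=
  (hu.pos_of_eval_eq one_ne_zero (fun _ => 1) (fun _ => zero_le_one) (by simp)).1

/-! ### Orthogonality to lower degrees; the zeros are real and simple -/

lemma degree_lt_of_degree_lt_succ {q : ℂ[X]} {m : ℕ} (h : q.degree < (m + 1 : ℕ))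
    (hc : q.coeff m = 0) : q.degree < m := by
  rw [degree_lt_iff_coeff_zero] at h ⊢
  intro k hk
  rcases hk.eq_or_lt with rfl | hk
  · exact hc
  · exact h k hk

/-- A linear functional that kills `P 0, …, P (m-1)` kills all polynomials of degree `< m`. -/
lemma IsMonicOPS.eq_zero_of_degree_lt (hP : IsMonicOPS u P) (L : ℂ[X] →ₗ[ℂ] ℂ) (m : ℕ)
    (hL : ∀ k < m, L (P k) = 0) {q : ℂ[X]} (hq : q.degree < m) : L q = 0 := by
  induction m generalizing q with
  | zero =>
    have : q = 0 := by simpa using hq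
    simp [this]
  | succ m ih =>
    have hd : (P m).degree = m := by
      rw [degree_eq_natDegree (hP.monic m).ne_zero, hP.natDegree_eq]
    have hlc : (P m).coeff m = 1 := by
      have := hP.monic m
      rwa [Monic, leadingCoeff, hP.natDegree_eq] at this
    have h1 : (q - q.coeff m • P m).degree < m := by
      apply degree_lt_of_degree_lt_succ
      · refine (degree_sub_le _ _).trans_lt (max_lt hq ((degree_smul_le _ _).trans_lt ?_))
        rw [hd]; exact_mod_cast Nat.lt_succ_self m
      · simp [hlc]
    have h2 := ih (fun k hk => hL k (by omega)) h1
    rw [map_sub, map_smul, hL m (by omega), smul_zero, sub_zero] at h2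
    exact h2

/-- The functional `q ↦ ⟨u, p q⟩`. -/
noncomputable def mulFunctional (u : ℂ[X] →ₗ[ℂ] ℂ) (p : ℂ[X]) : ℂ[X] →ₗ[ℂ] ℂ :=
  u ∘ₗ LinearMap.mulLeft ℂ p

@[simp] lemma mulFunctional_apply (p q : ℂ[X]) : mulFunctional u p q = u (p * q) := rfl

lemma IsMonicOPS.map_mul_eq_zero (hP : IsMonicOPS u P) {n : ℕ} {q : ℂ[X]} (hq : q.degree < n) :
    u (P n * q) = 0 :=
  hP.eq_zero_of_degree_lt (mulFunctional u (P n)) n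
    (fun k hk => hP.orthogonal n k (by omega)) hq

lemma IsMonicOPS.degree_eq (hP : IsMonicOPS u P) (n : ℕ) : (P n).degree = n := by
  rw [degree_eq_natDegree (hP.monic n).ne_zero, hP.natDegree_eq]

lemma IsMonicOPS.ne_zero (hP : IsMonicOPS u P) (n : ℕ) : P n ≠ 0 := (hP.monic n).ne_zero

lemma IsMonicOPS.degree_lt_of_factor (hP : IsMonicOPS u P) {n : ℕ} {d q : ℂ[X]}
    (hd : 0 < d.degree) (h : P n = d * q) : q.degree < n := by
  have hd0 : d ≠ 0 := by rintro rfl; simp at hd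
  have hq0 : q ≠ 0 := by rintro rfl; simp [hP.ne_zero] at h
  have := hP.natDegree_eq n
  rw [h, natDegree_mul hd0 hq0] at this
  rw [degree_eq_natDegree hq0]
  have := natDegree_pos_iff_degree_pos.2 hd
  exact_mod_cast (by omega)

/-- With `P n = (X - r) q`, orthogonality to `conjPoly q` says that `r` is the ratio of `u (X q
q̄)`, which is real, to `u (q q̄)`, which is positive. -/
lemma IsMonicOPS.root_im (hu : IsPosDef u) (hP : IsMonicOPS u P) {n : ℕ} {r : ℂ}
    (hr : (P n).eval r = 0) : r.im = 0 := by
  obtain ⟨q, hq⟩ := dvd_iff_isRoot.2 hr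
  have hq0 : q ≠ 0 := by rintro rfl; simp [hP.ne_zero] at hq
  have h0 := hP.map_mul_eq_zero (n := n) (q := conjPoly q)
    (by rw [degree_conjPoly]; exact hP.degree_lt_of_factor (by simp) hq)
  rw [hq, mul_assoc, sub_mul, map_sub, map_C_mul, sub_eq_zero] at h0
  have h1 := hu.im_X_mul_conj hq0
  obtain ⟨h2, h3⟩ := hu.mul_conj hq0
  rw [h0, Complex.mul_im, h3] at h1
  simp only [mul_zero, zero_add] at h1
  exact (mul_eq_zero.1 h1).resolve_right h2.ne'

lemma IsMonicOPS.root_eq_re (hu : IsPosDef u) (hP : IsMonicOPS u P) {n : ℕ} {r : ℂ}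
    (hr : (P n).eval r = 0) : ((r.re : ℝ) : ℂ) = r :=
  Complex.ext rfl (by simp [hP.root_im hu hr])

/-- A double zero is real, so `P n` times the conjugate of its cofactor is nonnegative on the line,
yet `u` kills it by orthogonality. -/
lemma IsMonicOPS.not_sq_dvd (hu : IsPosDef u) (hP : IsMonicOPS u P) {n : ℕ} {r : ℂ} :
    ¬ (X - C r) ^ 2 ∣ P n := by
  rintro ⟨q, hq⟩
  have hr : (P n).eval r = 0 := by simp [hq]
  rw [← hP.root_eq_re hu hr] at hq
  have hq0 : q ≠ 0 := by rintro rfl; simp [hP.ne_zero] at hq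
  have h0 := hP.map_mul_eq_zero (n := n) (q := conjPoly q)
    (by rw [degree_conjPoly]; exact hP.degree_lt_of_factor (by simp [degree_pow]) hq)
  rw [hq, mul_assoc] at h0
  have := (hu.sq_mul_conj hq0 r.re).1
  rw [h0] at this
  simp at this

/-- The set of zeros of `P n`. -/
noncomputable def zeros (P : ℕ → ℂ[X]) (n : ℕ) : Finset ℂ := (P n).roots.toFinset

lemma IsMonicOPS.mem_zeros (hP : IsMonicOPS u P) {n : ℕ} {r : ℂ} :
    r ∈ zeros P n ↔ (P n).eval r = 0 := by
  simp [zeros, hP.ne_zero]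

lemma IsMonicOPS.card_zeros (hu : IsPosDef u) (hP : IsMonicOPS u P) (n : ℕ) :
    (zeros P n).card = n := by
  classical
  have hnd : (P n).roots.Nodup := by
    rw [Multiset.nodup_iff_count_le_one]
    intro r
    rw [count_roots]
    by_contra! h
    exact hP.not_sq_dvd hu ((pow_dvd_pow _ h).trans (pow_rootMultiplicity_dvd (P n) r))
  rw [zeros, Multiset.toFinset_card_of_nodup hnd,
    IsAlgClosed.card_roots_eq_natDegree, hP.natDegree_eq]

/-! ### Difference quotients and Gauss quadrature -/

lemma X_sub_C_mul_divByMonic_add (p : ℂ[X]) (z : ℂ) :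
    (X - C z) * (p /ₘ (X - C z)) + C (p.eval z) = p := by
  rw [X_sub_C_mul_divByMonic_eq_sub_modByMonic, modByMonic_X_sub_C_eq_C_eval]; ring

lemma eval_divByMonic_of_ne (p : ℂ[X]) {z r : ℂ} (h : r ≠ z) :
    (p /ₘ (X - C z)).eval r = (p.eval r - p.eval z) / (r - z) := by
  have := congrArg (eval r) (X_sub_C_mul_divByMonic_add p z)
  simp only [eval_add, eval_mul, eval_sub, eval_X, eval_C] at this
  rw [eq_div_iff (sub_ne_zero.2 h)]
  linear_combination this

lemma eval_divByMonic_self (p : ℂ[X]) (z : ℂ) :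
    (p /ₘ (X - C z)).eval z = p.derivative.eval z := by
  have := congrArg (fun q => eval z (derivative q)) (X_sub_C_mul_divByMonic_add p z)
  simpa using this

lemma IsMonicOPS.degree_divByMonic (hP : IsMonicOPS u P) (n : ℕ) (z : ℂ) :
    ((P n) /ₘ (X - C z)).degree < n := by
  by_cases h : P n /ₘ (X - C z) = 0
  · rw [h]; simp
  have hn : n ≠ 0 := by
    rintro rfl
    apply h
    rw [divByMonic_eq_zero_iff (monic_X_sub_C z), hP.degree_eq]
    simp
  rw [degree_eq_natDegree h, natDegree_divByMonic _ (monic_X_sub_C z), hP.natDegree_eq]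
  simp only [natDegree_X_sub_C]
  exact_mod_cast (by omega)

lemma IsMonicOPS.eval_derivative_ne_zero (hu : IsPosDef u) (hP : IsMonicOPS u P) {n : ℕ} {r : ℂ}
    (hr : (P n).eval r = 0) : (P n).derivative.eval r ≠ 0 := by
  rw [← eval_divByMonic_self]
  intro h
  refine hP.not_sq_dvd hu (n := n) (r := r) ?_
  obtain ⟨s, hs⟩ := dvd_iff_isRoot.2 h
  refine ⟨s, ?_⟩
  rw [pow_two, mul_assoc, ← hs, mul_divByMonic_eq_iff_isRoot.2 hr]

/-- Gauss quadrature. -/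
lemma IsMonicOPS.quadrature (hu : IsPosDef u) (hP : IsMonicOPS u P) (n : ℕ) {p : ℂ[X]}
    (hp : p.degree < (2 * n : ℕ)) :
    u p = ∑ r ∈ zeros P n, gaussWeight u (P n) r * p.eval r := by
  have hm := hP.monic n
  have hdiv := modByMonic_add_div p (P n)
  set s := p /ₘ P n
  set t := p %ₘ P n
  have ht : t.degree < n := by
    have := degree_modByMonic_lt p hm
    rwa [hP.degree_eq] at this
  have hs : s.degree < n := by
    by_cases h : s = 0
    · rw [h]; simp
    by_cases hp0 : p = 0
    · exact absurd (by simp [s, hp0]) h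
    have h1 := natDegree_divByMonic p hm
    have h2 : p.natDegree < 2 * n := (natDegree_lt_iff_degree_lt hp0).2 hp
    rw [hP.natDegree_eq] at h1
    rw [degree_eq_natDegree h, h1]
    exact_mod_cast (by omega)
  have hval : ∀ r ∈ zeros P n, p.eval r = t.eval r := by
    intro r hr
    rw [hP.mem_zeros] at hr
    conv_lhs => rw [← hdiv]
    simp [hr]
  -- The quotient by `P n` has degree below `n`, so orthogonality leaves only the remainder; this is
  -- what doubles the exactness of interpolation.
  have hup : u p = u t := by
    conv_lhs => rw [← hdiv]
    rw [map_add, hP.map_mul_eq_zero hs, add_zero]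
  rw [hup, Finset.sum_congr rfl fun r hr => by rw [hval r hr]]
  -- Lagrange interpolation at the `n` distinct zeros.
  have hlag : t = ∑ r ∈ zeros P n, t.eval r •
      (C ((P n).derivative.eval r)⁻¹ * (P n /ₘ (X - C r))) := by
    refine eq_of_degrees_lt_of_eval_finset_eq (zeros P n) ?_ ?_ ?_
    · rwa [hP.card_zeros hu]
    · rw [hP.card_zeros hu]
      refine (degree_sum_le _ _).trans_lt ((Finset.sup_lt_iff (WithBot.bot_lt_coe n)).2 ?_)
      intro r _
      refine (degree_smul_le _ _).trans_lt ?_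
      rw [← smul_eq_C_mul]
      exact (degree_smul_le _ _).trans_lt (hP.degree_divByMonic n r)
    · intro r hr
      rw [eval_finsetSum, Finset.sum_eq_single r]
      · rw [eval_smul, eval_mul, eval_C, eval_divByMonic_self,
          inv_mul_cancel₀ (hP.eval_derivative_ne_zero hu (hP.mem_zeros.1 hr))]
        simp
      · intro b hb hbr
        rw [eval_smul, eval_mul, eval_divByMonic_of_ne _ hbr.symm, hP.mem_zeros.1 hb,
          hP.mem_zeros.1 hr]
        simp
      · exact fun h => absurd hr h
  conv_lhs => rw [hlag]
  rw [map_sum]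
  refine Finset.sum_congr rfl fun r _ => ?_
  rw [map_smul, smul_eq_mul, gaussWeight, mul_comm]

/-- Quadrature applied to `q q̄` with `q = P n / (X - r)`: every node except `r` drops out, and the
left side is positive. -/
lemma IsMonicOPS.gaussWeight_pos (hu : IsPosDef u) (hP : IsMonicOPS u P) {n : ℕ} {r : ℂ}
    (hr : (P n).eval r = 0) :
    0 < (gaussWeight u (P n) r).re ∧ (gaussWeight u (P n) r).im = 0 := by
  set q := P n /ₘ (X - C r) with hq
  have hqr : q.eval r ≠ 0 := by
    rw [hq, eval_divByMonic_self]; exact hP.eval_derivative_ne_zero hu hr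
  have hq0 : q ≠ 0 := by intro h; simp [h] at hqr
  have hd : (q * conjPoly q).degree < (2 * n : ℕ) := by
    have h := hP.degree_divByMonic n r
    rw [← hq, degree_eq_natDegree hq0] at h
    rw [degree_mul, degree_conjPoly, degree_eq_natDegree hq0]
    have h' : q.natDegree < n := by exact_mod_cast h
    exact_mod_cast (by omega)
  have h1 := hP.quadrature hu n hd
  rw [Finset.sum_eq_single r] at h1
  · obtain ⟨h2, h3⟩ := hu.mul_conj hq0
    rw [h1] at h2 h3
    rw [← hP.root_eq_re hu hr, eval_mul_conjPoly, hP.root_eq_re hu hr] at h2 h3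
    have hpos : 0 < ‖q.eval r‖ ^ 2 := by positivity
    rw [Complex.re_mul_ofReal] at h2
    rw [Complex.im_mul_ofReal] at h3
    exact ⟨(pos_iff_pos_of_mul_pos h2).2 hpos, (mul_eq_zero.1 h3).resolve_right hpos.ne'⟩
  · intro b hb hbr
    rw [eval_mul, hq, eval_divByMonic_of_ne _ hbr, hP.mem_zeros.1 hb, hr]
    simp
  · exact fun h => absurd (hP.mem_zeros.2 hr) h

/-- The real Gauss weight. -/
noncomputable def weight (u : ℂ[X] →ₗ[ℂ] ℂ) (P : ℕ → ℂ[X]) (n : ℕ) (r : ℂ) : ℝ :=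
  (gaussWeight u (P n) r).re

lemma IsMonicOPS.weight_pos (hu : IsPosDef u) (hP : IsMonicOPS u P) {n : ℕ} {r : ℂ}
    (hr : r ∈ zeros P n) : 0 < weight u P n r :=
  (hP.gaussWeight_pos hu (hP.mem_zeros.1 hr)).1

lemma IsMonicOPS.quadrature_weight (hu : IsPosDef u) (hP : IsMonicOPS u P) (n : ℕ) {p : ℂ[X]}
    (hp : p.degree < (2 * n : ℕ)) :
    u p = ∑ r ∈ zeros P n, (weight u P n r : ℂ) * p.eval (r.re : ℂ) := by
  rw [hP.quadrature hu n hp]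
  refine Finset.sum_congr rfl fun r hr => ?_
  have hr := hP.mem_zeros.1 hr
  rw [hP.root_eq_re hu hr]
  congr 1
  exact Complex.ext rfl (by simp [(hP.gaussWeight_pos hu hr).2])

/-! ### Recurrence, associated polynomials and partial fractions -/

lemma IsMonicOPS.recurrence (hu : IsPosDef u) (hP : IsMonicOPS u P) (n : ℕ) :
    P (n + 2) = (X - C (beta u P (n + 1))) * P (n + 1) - C (gamma u P (n + 1)) * P n := by
  set d := P (n + 2) - ((X - C (beta u P (n + 1))) * P (n + 1) - C (gamma u P (n + 1)) * P n)
    with hd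
  rw [← sub_eq_zero, ← hd]
  have hmon : ∀ k : ℕ, (X * P k - P (k + 1)).degree < ((k + 1 : ℕ) : WithBot ℕ) := by
    intro k
    have h1 : (X * P k).degree = (P (k + 1)).degree := by
      rw [degree_mul, degree_X, hP.degree_eq, hP.degree_eq]; push_cast; ring
    have := degree_sub_lt_left h1 (mul_ne_zero X_ne_zero (hP.ne_zero k))
      (by rw [((monic_X).mul (hP.monic k)).leadingCoeff, (hP.monic _).leadingCoeff])
    rwa [h1, hP.degree_eq] at this
  have hX : ∀ k, u (P (k + 1) * (X * P k)) = u (P (k + 1) ^ 2) := by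
    intro k
    have := hP.map_mul_eq_zero (hmon k)
    rw [mul_sub, map_sub, sub_eq_zero] at this
    rw [this, pow_two]
  have hnz : ∀ k, u (P k ^ 2) ≠ 0 := fun k => by rw [pow_two]; exact hP.norm_ne_zero k
  have hdeg : d.degree < (n + 2 : ℕ) := by
    have e : d = C (beta u P (n + 1)) * P (n + 1) + C (gamma u P (n + 1)) * P n
        - (X * P (n + 1) - P (n + 2)) := by rw [hd]; ring
    rw [e]
    refine (degree_sub_le _ _).trans_lt (max_lt ?_ (hmon (n + 1)))
    refine (degree_add_le _ _).trans_lt (max_lt ?_ ?_) <;>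
    · rw [C_mul']
      refine (degree_smul_le _ _).trans_lt ?_
      rw [hP.degree_eq]
      exact_mod_cast (by omega)
  have hk : ∀ k < n + 2, mulFunctional u d (P k) = 0 := by
    intro k hk
    have e : mulFunctional u d (P k) = u (P (n + 2) * P k) - u (P (n + 1) * (X * P k))
        + beta u P (n + 1) * u (P (n + 1) * P k) + gamma u P (n + 1) * u (P n * P k) := by
      rw [← map_C_mul, ← map_C_mul, ← map_sub, ← map_add, ← map_add, mulFunctional_apply]
      congr 1
      rw [hd]; ring
    rw [e, hP.orthogonal (n + 2) k (by omega)]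
    rcases (by omega : k < n ∨ k = n ∨ k = n + 1) with h | rfl | rfl
    · rw [hP.orthogonal (n + 1) k (by omega), hP.orthogonal n k (by omega), hP.map_mul_eq_zero]
      · ring
      · rw [degree_mul, degree_X, hP.degree_eq]
        exact_mod_cast (by omega)
    · rw [hX, hP.orthogonal (k + 1) k (by omega), gamma, ← pow_two, div_mul_cancel₀ _ (hnz k)]
      ring
    · rw [hP.orthogonal n (n + 1) (by omega), beta, ← pow_two, div_mul_cancel₀ _ (hnz _),
        show P (n + 1) * (X * P (n + 1)) = X * P (n + 1) ^ 2 by ring]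
      ring
  -- The defect `d` has degree below `n + 2` and is orthogonal to `P 0, …, P (n + 1)`, hence to its
  -- own conjugate, which contradicts positivity unless `d = 0`.
  by_contra h0
  have h1 := hP.eq_zero_of_degree_lt _ _ hk (q := conjPoly d) (by rwa [degree_conjPoly])
  have h2 := (hu.mul_conj h0).1
  rw [mulFunctional_apply] at h1
  rw [h1] at h2
  simp at h2

lemma divByMonic_recurrence (p q : ℂ[X]) (b c z : ℂ) :
    ((X - C b) * p - C c * q) /ₘ (X - C z) =
      (C (z - b) * (p /ₘ (X - C z)) + p) - C c * (q /ₘ (X - C z)) := by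
  apply mul_left_cancel₀ (X_sub_C_ne_zero z)
  have h1 := X_sub_C_mul_divByMonic_add ((X - C b) * p - C c * q) z
  have h2 := X_sub_C_mul_divByMonic_add p z
  have h3 := X_sub_C_mul_divByMonic_add q z
  simp only [eval_sub, eval_mul, eval_X, eval_C, C_sub, C_mul] at h1 ⊢
  linear_combination h1 - (C z - C b) * h2 + C c * h3

/-- Dividing the recurrence by `X - z` produces one extra term, `P (m + 1)`, which `u` annihilates.
Both sides thus satisfy the same recurrence, and the initial values match. -/
lemma IsMonicOPS.u_divByMonic (hu : IsPosDef u) (hP : IsMonicOPS u P) (z : ℂ) (n : ℕ) :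
    u (P (n + 1) /ₘ (X - C z)) = u 1 * (associated u P 1 n).eval z := by
  have hrec : ∀ m, u (P (m + 2) /ₘ (X - C z)) =
      (z - beta u P (m + 1)) * u (P (m + 1) /ₘ (X - C z)) -
        gamma u P (m + 1) * u (P m /ₘ (X - C z)) := by
    intro m
    have h1 : u (P (m + 1)) = 0 := by
      have := hP.map_mul_eq_zero (n := m + 1) (q := 1) (by rw [degree_one]; exact_mod_cast (by omega))
      rwa [mul_one] at this
    rw [hP.recurrence hu, divByMonic_recurrence, map_sub, map_add, h1, map_C_mul, map_C_mul, add_zero]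
  have h0 : P 0 = 1 := (hP.monic 0).natDegree_eq_zero.1 (hP.natDegree_eq 0)
  have hd0 : P 0 /ₘ (X - C z) = 0 := by
    rw [divByMonic_eq_zero_iff (monic_X_sub_C z), hP.degree_eq]; simp
  have hd1 : P 1 /ₘ (X - C z) = 1 := by
    have := (hP.monic 1).eq_X_add_C (hP.natDegree_eq 1)
    have h2 := X_sub_C_mul_divByMonic_add (P 1) z
    apply mul_left_cancel₀ (X_sub_C_ne_zero z)
    rw [this] at h2 ⊢
    simp only [eval_add, eval_X, eval_C, C_add] at h2
    linear_combination h2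
  induction n using Nat.strong_induction_on with
  | _ n ih =>
    match n with
    | 0 => simp [hd1, associated]
    | 1 => rw [hrec 0, hd0, hd1]; simp [associated, mul_comm]
    | n + 2 =>
      rw [hrec (n + 1), ih (n + 1) (by omega), ih n (by omega), associated]
      simp only [eval_sub, eval_mul, eval_X, eval_C]
      ring

lemma IsMonicOPS.quotient_eq (hu : IsPosDef u) (hP : IsMonicOPS u P) (n : ℕ) {z : ℂ}
    (hz : (P (n + 1)).eval z ≠ 0) :
    u 1 * (associated u P 1 n).eval z / (P (n + 1)).eval z =
      ∑ r ∈ zeros P (n + 1), (weight u P (n + 1) r : ℂ) * (1 / (z - (r.re : ℂ))) := by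
  rw [← hP.u_divByMonic hu, hP.quadrature_weight hu (n + 1)
    ((hP.degree_divByMonic _ z).trans_le (by exact_mod_cast (by omega))), Finset.sum_div]
  refine Finset.sum_congr rfl fun r hr => ?_
  have hr := hP.mem_zeros.1 hr
  rw [hP.root_eq_re hu hr]
  have hne : r ≠ z := by rintro rfl; exact hz hr
  rw [eval_divByMonic_of_ne _ hne, hr]
  have h1 := sub_ne_zero.2 hne
  have h2 := sub_ne_zero.2 hne.symm
  field_simp
  ring

/-! ### From distribution functions to integrals -/

/-- Integration by parts against a finite measure on an interval. -/
lemma setIntegral_Ioc_by_parts (m : Measure ℝ) [IsFiniteMeasure m] {f f' : ℝ → ℝ}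
    (hf : ∀ x, HasDerivAt f (f' x) x) (hf' : Continuous f') (a b : ℝ) :
    ∫ x in Set.Ioc a b, f x ∂m =
      f b * m.real (Set.Ioc a b) - ∫ t in Set.Ioc a b, f' t * m.real (Set.Ioc a t) := by
  have hfc : Continuous f := continuous_iff_continuousAt.2 fun x => (hf x).continuousAt
  have hint : IntegrableOn f' (Set.Ioc a b) :=
    (hf'.integrableOn_Icc (a := a) (b := b)).mono_set Set.Ioc_subset_Icc_self
  have hfint : IntegrableOn f (Set.Ioc a b) m :=
    (hfc.integrableOn_Icc (a := a) (b := b)).mono_set Set.Ioc_subset_Icc_self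
  -- Fubini for `f' t` on the triangle `x ≤ t`: integrating in `t` first gives `f b - f x`,
  -- integrating in `x` first gives the distribution function.
  have hprod : Integrable (Function.uncurry fun x t : ℝ =>
      Set.indicator {q : ℝ × ℝ | q.1 ≤ q.2} (fun q => f' q.2) (x, t))
      ((m.restrict (Set.Ioc a b)).prod (volume.restrict (Set.Ioc a b))) :=
    (hint.comp_snd (m.restrict (Set.Ioc a b))).indicator (measurableSet_le measurable_fst
      measurable_snd)
  have hswap := integral_integral_swap hprod
  have h1 : ∀ x ∈ Set.Ioc a b, ∫ t in Set.Ioc a b,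
      Set.indicator {q : ℝ × ℝ | q.1 ≤ q.2} (fun q => f' q.2) (x, t) = f b - f x := by
    intro x hx
    have e : (fun t => Set.indicator {q : ℝ × ℝ | q.1 ≤ q.2} (fun q => f' q.2) (x, t)) =
        Set.indicator (Set.Ici x) f' := by
      funext t; simp [Set.indicator_apply]
    rw [e, setIntegral_indicator measurableSet_Ici,
      show Set.Ioc a b ∩ Set.Ici x = Set.Icc x b by
        ext t; simp only [Set.mem_inter_iff, Set.mem_Ioc, Set.mem_Ici, Set.mem_Icc]
        exact ⟨fun h => ⟨h.2, h.1.2⟩, fun h => ⟨⟨hx.1.trans_le h.1, h.2⟩, h.1⟩⟩,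
      integral_Icc_eq_integral_Ioc, ← intervalIntegral.integral_of_le hx.2]
    exact intervalIntegral.integral_eq_sub_of_hasDerivAt (fun y _ => hf y)
      (hf'.intervalIntegrable _ _)
  have h2 : ∀ t ∈ Set.Ioc a b, ∫ x in Set.Ioc a b,
      Set.indicator {q : ℝ × ℝ | q.1 ≤ q.2} (fun q => f' q.2) (x, t) ∂m =
        f' t * m.real (Set.Ioc a t) := by
    intro t ht
    have e : (fun x => Set.indicator {q : ℝ × ℝ | q.1 ≤ q.2} (fun q => f' q.2) (x, t)) =
        Set.indicator (Set.Iic t) fun _ => f' t := by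
      funext x; simp [Set.indicator_apply]
    rw [e, setIntegral_indicator measurableSet_Iic, Set.Ioc_inter_Iic, min_eq_right ht.2,
      setIntegral_const, smul_eq_mul, mul_comm]
  rw [setIntegral_congr_fun measurableSet_Ioc h1, setIntegral_congr_fun measurableSet_Ioc h2,
    integral_sub (integrable_const _) hfint, setIntegral_const, smul_eq_mul] at hswap
  linarith

/-- Convergence of distribution functions implies convergence of integrals over an interval. -/
lemma tendsto_setIntegral_Ioc {m : ℕ → Measure ℝ} [∀ j, IsFiniteMeasure (m j)] {ν : Measure ℝ}
    [IsFiniteMeasure ν] {f f' : ℝ → ℝ} (hf : ∀ x, HasDerivAt f (f' x) x) (hf' : Continuous f')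
    {a b B : ℝ} (hB : ∀ᶠ j in atTop, (m j).real Set.univ ≤ B)
    (hb : Tendsto (fun j => (m j).real (Set.Ioc a b)) atTop (𝓝 (ν.real (Set.Ioc a b))))
    (hae : ∀ᵐ t, t ∈ Set.Ioc a b →
      Tendsto (fun j => (m j).real (Set.Ioc a t)) atTop (𝓝 (ν.real (Set.Ioc a t)))) :
    Tendsto (fun j => ∫ x in Set.Ioc a b, f x ∂(m j)) atTop
      (𝓝 (∫ x in Set.Ioc a b, f x ∂ν)) := by
  simp only [fun j => setIntegral_Ioc_by_parts (m j) hf hf' a b]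
  rw [setIntegral_Ioc_by_parts ν hf hf' a b]
  refine (hb.const_mul _).sub ?_
  refine tendsto_integral_filter_of_dominated_convergence (fun t => |f' t| * B) ?_ ?_ ?_ ?_
  · refine Eventually.of_forall fun j => (hf'.measurable.mul ?_).aestronglyMeasurable
    exact Monotone.measurable fun s t hst => measureReal_mono (Set.Ioc_subset_Ioc_right hst)
  · filter_upwards [hB] with j hj
    refine Eventually.of_forall fun t => ?_
    rw [norm_mul, Real.norm_eq_abs, Real.norm_eq_abs, abs_of_nonneg measureReal_nonneg]
    exact mul_le_mul_of_nonneg_left ((measureReal_mono (Set.subset_univ _)).trans hj)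
      (abs_nonneg _)
  · exact ((hf'.abs.mul continuous_const).integrableOn_Icc (a := a) (b := b)).mono_set
      Set.Ioc_subset_Icc_self
  · rw [ae_restrict_iff' measurableSet_Ioc]
    filter_upwards [hae] with t ht hmem
    exact (ht hmem).const_mul _

/-! ### Gauss measures and the step functions -/

/-- The discrete measure of the Gauss quadrature with `n` nodes. -/
noncomputable def gaussMeasure (u : ℂ[X] →ₗ[ℂ] ℂ) (P : ℕ → ℂ[X]) (n : ℕ) : Measure ℝ :=
  ∑ r ∈ zeros P n, ENNReal.ofReal (weight u P n r) • Measure.dirac r.re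

instance (u : ℂ[X] →ₗ[ℂ] ℂ) (P : ℕ → ℂ[X]) (n : ℕ) : IsFiniteMeasure (gaussMeasure u P n) := by
  constructor
  simp [gaussMeasure, Measure.finsetSum_apply]

variable {ψ : ℝ → ℝ}

lemma integrable_gaussMeasure {E : Type*} [NormedAddCommGroup E] (n : ℕ) (f : ℝ → E) :
    Integrable f (gaussMeasure u P n) :=
  integrable_finsetSum_measure.2 fun _ _ =>
    (integrable_dirac (by simp)).smul_measure (by simp)

lemma IsMonicOPS.integral_gaussMeasure {E : Type*} [NormedAddCommGroup E] [NormedSpace ℝ E]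
    [CompleteSpace E] (hu : IsPosDef u) (hP : IsMonicOPS u P) (n : ℕ) (f : ℝ → E) :
    ∫ x, f x ∂(gaussMeasure u P n) = ∑ r ∈ zeros P n, weight u P n r • f r.re := by
  rw [gaussMeasure, integral_finsetSum_measure
    fun _ _ => (integrable_dirac (by simp)).smul_measure (by simp)]
  refine Finset.sum_congr rfl fun r hr => ?_
  rw [integral_smul_measure, integral_dirac, ENNReal.toReal_ofReal (hP.weight_pos hu hr).le]

lemma IsMonicOPS.integral_gaussMeasure_eval (hu : IsPosDef u) (hP : IsMonicOPS u P) (n : ℕ)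
    {p : ℂ[X]} (hp : p.degree < (2 * n : ℕ)) :
    u p = ∫ x : ℝ, p.eval (x : ℂ) ∂(gaussMeasure u P n) := by
  rw [hP.integral_gaussMeasure hu, hP.quadrature_weight hu n hp]
  simp

lemma IsMonicOPS.u_X_pow (hu : IsPosDef u) (hP : IsMonicOPS u P) {n k : ℕ} (hk : k < 2 * n) :
    u (X ^ k) = ((∫ x : ℝ, x ^ k ∂(gaussMeasure u P n) : ℝ) : ℂ) := by
  rw [hP.integral_gaussMeasure_eval hu n (p := X ^ k)
    (by rw [degree_X_pow]; exact_mod_cast hk), ← integral_complex_ofReal]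
  simp

lemma IsMonicOPS.gaussMeasure_univ (hu : IsPosDef u) (hP : IsMonicOPS u P) {n : ℕ} (hn : 0 < n) :
    (gaussMeasure u P n).real Set.univ = (u 1).re := by
  have := hP.u_X_pow hu (n := n) (k := 0) (by omega)
  simp only [pow_zero, integral_const, smul_eq_mul, mul_one] at this
  rw [this, Complex.ofReal_re]

lemma IsMonicOPS.gaussMeasure_Iic (hu : IsPosDef u) (hP : IsMonicOPS u P) (n : ℕ) (x : ℝ) :
    (gaussMeasure u P n).real (Set.Iic x) = stepDist u (P n) x := by
  classical
  rw [← integral_indicator_one measurableSet_Iic, hP.integral_gaussMeasure hu, stepDist,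
    Finset.sum_filter]
  refine Finset.sum_congr rfl fun r _ => ?_
  by_cases h : r.re ≤ x <;> simp [h, weight]

lemma IsMonicOPS.gaussMeasure_Ioc (hu : IsPosDef u) (hP : IsMonicOPS u P) (n : ℕ) {a b : ℝ}
    (hab : a ≤ b) :
    (gaussMeasure u P n).real (Set.Ioc a b) = stepDist u (P n) b - stepDist u (P n) a := by
  rw [← hP.gaussMeasure_Iic hu, ← hP.gaussMeasure_Iic hu, ← Set.Iic_sdiff_Iic,
    measureReal_sdiff (Set.Iic_subset_Iic.2 hab) measurableSet_Iic]

lemma IsMonicOPS.stepDist_mono (hu : IsPosDef u) (hP : IsMonicOPS u P) (n : ℕ) :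
    Monotone (stepDist u (P n)) := fun a b hab => by
  rw [← hP.gaussMeasure_Iic hu, ← hP.gaussMeasure_Iic hu]
  exact measureReal_mono (Set.Iic_subset_Iic.2 hab)

/-! ### The Stieltjes measure of a natural representative -/

lemma IsNaturalRepresentative.monotone (hu : IsPosDef u) (hP : IsMonicOPS u P)
    (hψ : IsNaturalRepresentative u P ψ) : Monotone ψ := by
  obtain ⟨φ, -, hlim⟩ := hψ
  exact fun a b hab => le_of_tendsto_of_tendsto' (hlim a) (hlim b)
    fun j => hP.stepDist_mono hu (φ j) hab

lemma IsNaturalRepresentative.abs_le (hu : IsPosDef u) (hP : IsMonicOPS u P)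
    (hψ : IsNaturalRepresentative u P ψ) (x : ℝ) : |ψ x| ≤ (u 1).re := by
  obtain ⟨φ, hφ, hlim⟩ := hψ
  refine le_of_tendsto (hlim x).abs ?_
  filter_upwards [eventually_ge_atTop 1] with j hj
  rw [← hP.gaussMeasure_Iic hu, abs_of_nonneg measureReal_nonneg,
    ← hP.gaussMeasure_univ hu (n := φ j) (by have := hφ.id_le j; simp only [id] at this; omega)]
  exact measureReal_mono (Set.subset_univ _)

lemma isFiniteMeasure_stieltjes {C : ℝ} (hmono : Monotone ψ) (hC : ∀ x, |ψ x| ≤ C) :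
    IsFiniteMeasure hmono.stieltjesFunction.measure := by
  refine hmono.stieltjesFunction.isFiniteMeasure_of_forall_abs_le (C := C) fun x => ?_
  rw [hmono.stieltjesFunction_eq, abs_le]
  exact ⟨(abs_le.1 (hC x)).1.trans (hmono.le_rightLim le_rfl),
    (hmono.rightLim_le (lt_add_one x)).trans (abs_le.1 (hC (x + 1))).2⟩

lemma stieltjes_Ioc (hmono : Monotone ψ) {a b : ℝ} (hab : a ≤ b) (ha : ContinuousAt ψ a)
    (hb : ContinuousAt ψ b) :
    hmono.stieltjesFunction.measure.real (Set.Ioc a b) = ψ b - ψ a := by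
  rw [Measure.real, StieltjesFunction.measure_Ioc, hmono.stieltjesFunction_eq,
    hmono.stieltjesFunction_eq, ha.continuousWithinAt.rightLim_eq,
    hb.continuousWithinAt.rightLim_eq, ENNReal.toReal_ofReal (sub_nonneg.2 (hmono hab))]

/-- The Stieltjes measure does not charge neighbourhoods on which `ψ` is constant. -/
lemma stieltjes_Ioc_eq_zero (hmono : Monotone ψ) {x δ : ℝ} (hδ : 0 < δ)
    (h : ψ (x + δ) - ψ (x - δ) ≤ 0) :
    hmono.stieltjesFunction.measure (Set.Ioc (x - δ / 2) (x + δ / 2)) = 0 := by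
  rw [StieltjesFunction.measure_Ioc, hmono.stieltjesFunction_eq, hmono.stieltjesFunction_eq,
    ENNReal.ofReal_eq_zero]
  -- The measure is built from right limits, which may exceed `ψ` at the endpoint; halving the
  -- interval leaves room for them.
  have h1 : Function.rightLim ψ (x + δ / 2) ≤ ψ (x + δ) := hmono.rightLim_le (by linarith)
  have h2 : ψ (x - δ) ≤ Function.rightLim ψ (x - δ / 2) :=
    (hmono (by linarith)).trans (hmono.le_rightLim le_rfl)
  linarith

lemma Ioc_half_mem_nhds {x δ : ℝ} (hδ : 0 < δ) : Set.Ioc (x - δ / 2) (x + δ / 2) ∈ 𝓝 x :=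
  Ioc_mem_nhds (by linarith) (by linarith)

lemma stieltjes_compl_spectrum (hmono : Monotone ψ) :
    hmono.stieltjesFunction.measure (spectrum ψ)ᶜ = 0 := by
  refine measure_null_of_locally_null _ fun x hx => ?_
  simp only [spectrum, Set.mem_compl_iff, Set.mem_ofPred_eq, not_forall, not_lt] at hx
  obtain ⟨δ, hδ, h⟩ := hx
  exact ⟨_, mem_nhdsWithin_of_mem_nhds (Ioc_half_mem_nhds hδ),
    stieltjes_Ioc_eq_zero hmono hδ h⟩

lemma exists_ae_mem_Icc (hmono : Monotone ψ) (hσ : Bornology.IsBounded (spectrum ψ)) :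
    ∃ R : ℝ, 0 < R ∧ ∀ᵐ x ∂hmono.stieltjesFunction.measure, x ∈ Set.Icc (-R) R := by
  obtain ⟨R, hR, h⟩ := hσ.exists_pos_norm_le
  refine ⟨R, hR, ?_⟩
  filter_upwards [measure_eq_zero_iff_ae_notMem.1 (stieltjes_compl_spectrum hmono)] with x hx
  exact abs_le.1 (h x (not_not.1 hx))

lemma integrable_of_ae_mem_Icc {E : Type*} [NormedAddCommGroup E] {ν : Measure ℝ}
    [IsFiniteMeasure ν] {R : ℝ} (hR : ∀ᵐ x ∂ν, x ∈ Set.Icc (-R) R) {f : ℝ → E}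
    (hf : Continuous f) : Integrable f ν := by
  rw [← Measure.restrict_eq_self_of_ae_mem hR]
  exact hf.integrableOn_Icc

lemma exists_continuousAt_gt (hmono : Monotone ψ) (N : ℝ) :
    ∃ M, N < M ∧ ContinuousAt ψ M ∧ ContinuousAt ψ (-M) := by
  have hc := hmono.countable_not_continuousAt
  obtain ⟨M, hM, hN⟩ := ((hc.union (hc.preimage neg_injective)).dense_compl ℝ).exists_gt N
  simp only [Set.mem_compl_iff, Set.mem_union, Set.mem_ofPred_eq, Set.mem_preimage, not_or,
    not_not] at hM
  exact ⟨M, hN, hM⟩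

/-! ### The Stieltjes measure represents `u` -/

/-- Controls the tail of a moment by a higher, even one, uniformly over the Gauss measures that
reproduce the latter. -/
lemma abs_pow_sub_indicator_le {M : ℝ} (hM : 1 ≤ M) (k : ℕ) (x : ℝ) :
    ‖x ^ k - (Set.Ioc (-M) M).indicator (fun y => y ^ k) x‖ ≤ x ^ (2 * k + 2) / M := by
  have hM0 : 0 < M := by linarith
  by_cases h : x ∈ Set.Ioc (-M) M
  · rw [Set.indicator_of_mem h, sub_self, norm_zero]
    have : 0 ≤ x ^ (2 * k + 2) := Even.pow_nonneg ⟨k + 1, by ring⟩ x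
    positivity
  · rw [Set.indicator_of_notMem h, sub_zero, le_div_iff₀ hM0, norm_pow, Real.norm_eq_abs,
      ← Even.pow_abs (n := 2 * k + 2) ⟨k + 1, by ring⟩,
      show 2 * k + 2 = k + (k + 1 + 1) by ring, pow_add |x| k]
    have hx : M ≤ |x| := by
      by_contra! hlt
      exact h ⟨(abs_lt.1 hlt).1, (abs_lt.1 hlt).2.le⟩
    refine mul_le_mul_of_nonneg_left ?_ (by positivity)
    rw [pow_succ]
    exact hx.trans (le_mul_of_one_le_left (abs_nonneg x) (one_le_pow₀ (hM.trans hx)))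

/-- A natural representative with bounded spectrum represents the functional on monomials. -/
lemma IsNaturalRepresentative.u_X_pow (hu : IsPosDef u) (hP : IsMonicOPS u P)
    (hψ : IsNaturalRepresentative u P ψ) (hmono : Monotone ψ) {R : ℝ}
    (hR : ∀ᵐ x ∂hmono.stieltjesFunction.measure, x ∈ Set.Icc (-R) R) (k : ℕ) :
    u (X ^ k) = ((∫ x : ℝ, x ^ k ∂hmono.stieltjesFunction.measure : ℝ) : ℂ) := by
  have habs := hψ.abs_le hu hP
  have := isFiniteMeasure_stieltjes hmono habs
  obtain ⟨φ, hφ, hlim⟩ := hψ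
  set ν := hmono.stieltjesFunction.measure
  -- Makes the quadrature exact for the moment of order `2 * k + 2` used in the tail bound.
  have hφk : ∀ᶠ j in atTop, k + 2 ≤ φ j := hφ.tendsto_atTop.eventually_ge_atTop _
  have him : u (X ^ k) = ((u (X ^ k)).re : ℂ) := by
    rw [hP.u_X_pow hu (n := k + 1) (by omega), Complex.ofReal_re]
  set c := (u (X ^ k)).re
  set D := (u (X ^ (2 * k + 2))).re with hD
  have key : ∀ N : ℝ, ∃ M, N < M ∧ |c - ∫ x, x ^ k ∂ν| ≤ D / M := by
    intro N
    -- `M > R` so that truncation does not affect `ν`, `M > 1` for the tail bound, and continuity at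
    -- `±M` so that the masses of `(-M, M]` converge.
    obtain ⟨M, hM, hc1, hc2⟩ := exists_continuousAt_gt hmono (max N (max R 1))
    simp only [max_lt_iff] at hM
    obtain ⟨hMN, hMR, hM1⟩ := hM
    have hMM : -M ≤ M := by linarith
    have hIoc : ∫ x in Set.Ioc (-M) M, x ^ k ∂ν = ∫ x, x ^ k ∂ν := by
      rw [Measure.restrict_eq_self_of_ae_mem]
      filter_upwards [hR] with x hx
      exact ⟨by linarith [hx.1], by linarith [hx.2]⟩
    refine ⟨M, hMN, ?_⟩
    rw [← hIoc]
    have hconv : ∀ t, -M ≤ t → ContinuousAt ψ t →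
        Tendsto (fun j => (gaussMeasure u P (φ j)).real (Set.Ioc (-M) t)) atTop
          (𝓝 (ν.real (Set.Ioc (-M) t))) := by
      intro t ht htc
      rw [stieltjes_Ioc hmono ht hc2 htc]
      simp only [fun j => hP.gaussMeasure_Ioc hu (φ j) ht]
      exact (hlim t).sub (hlim (-M))
    have ht : Tendsto (fun j => ∫ x in Set.Ioc (-M) M, x ^ k ∂(gaussMeasure u P (φ j))) atTop
        (𝓝 (∫ x in Set.Ioc (-M) M, x ^ k ∂ν)) := by
      refine tendsto_setIntegral_Ioc (f' := fun x => k * x ^ (k - 1)) (B := (u 1).re)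
        (fun x => hasDerivAt_pow k x) (by fun_prop) ?_ (hconv M hMM hc1) ?_
      · filter_upwards [hφk] with j hj
        exact (hP.gaussMeasure_univ hu (by omega)).le
      · filter_upwards [hmono.countable_not_continuousAt.ae_notMem volume] with t h1 h2
        exact hconv t h2.1.le (not_not.1 h1)
    refine le_of_tendsto (tendsto_const_nhds.sub ht).abs ?_
    filter_upwards [hφk] with j hj
    have e1 : c = ∫ x : ℝ, x ^ k ∂(gaussMeasure u P (φ j)) := by
      have := hP.u_X_pow hu (n := φ j) (k := k) (by omega)
      rw [him] at this
      exact_mod_cast this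
    have e2 : D = ∫ x : ℝ, x ^ (2 * k + 2) ∂(gaussMeasure u P (φ j)) := by
      rw [hD, hP.u_X_pow hu (n := φ j) (by omega), Complex.ofReal_re]
    rw [e1, e2, ← integral_indicator measurableSet_Ioc,
      ← integral_sub (integrable_gaussMeasure _ _) (integrable_gaussMeasure _ _),
      ← integral_div, ← Real.norm_eq_abs]
    exact norm_integral_le_of_norm_le (integrable_gaussMeasure _ _)
      (Eventually.of_forall (abs_pow_sub_indicator_le hM1.le k))
  rw [him]
  congr 1
  rw [← sub_eq_zero, ← abs_eq_zero]
  refine le_antisymm (le_of_forall_pos_le_add fun ε hε => ?_) (abs_nonneg _)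
  obtain ⟨M, hM, h⟩ := key (max (|D| / ε) 0)
  rw [max_lt_iff] at hM
  refine h.trans ((div_le_div_of_nonneg_right (le_abs_self D) hM.2.le).trans ?_)
  rw [zero_add, div_le_iff₀ hM.2]
  exact (((div_lt_iff₀' hε).1 hM.1)).le

lemma map_eq_integral {ν : Measure ℝ} [IsFiniteMeasure ν] {R : ℝ}
    (hR : ∀ᵐ x ∂ν, x ∈ Set.Icc (-R) R)
    (hmom : ∀ k, u (X ^ k) = ((∫ x : ℝ, x ^ k ∂ν : ℝ) : ℂ)) (p : ℂ[X]) :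
    u p = ∫ x : ℝ, p.eval (x : ℂ) ∂ν := by
  induction p using Polynomial.induction_on' with
  | add p q hp hq =>
    rw [map_add, hp, hq, ← integral_add]
    · simp
    · exact integrable_of_ae_mem_Icc hR (p.continuous.comp Complex.continuous_ofReal)
    · exact integrable_of_ae_mem_Icc hR (q.continuous.comp Complex.continuous_ofReal)
  | monomial k a =>
    rw [← C_mul_X_pow_eq_monomial, map_C_mul, hmom, ← integral_complex_ofReal,
      ← integral_const_mul]
    simp

/-! ### Location of the zeros and gaps in the support -/

/-- With `P n = (X - r) q`, orthogonality gives `∫ (x - r) |q|² dν = 0`. If `r` were outside the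
interval, `x - r` would have constant sign and be bounded away from zero there, while `∫ |q|² dν >
0`. -/
lemma IsMonicOPS.root_mem_Icc (hu : IsPosDef u) (hP : IsMonicOPS u P) {ν : Measure ℝ}
    [IsFiniteMeasure ν] {R : ℝ} (hR : ∀ᵐ x ∂ν, x ∈ Set.Icc (-R) R)
    (hint : ∀ p : ℂ[X], u p = ∫ x : ℝ, p.eval (x : ℂ) ∂ν) {n : ℕ} {r : ℂ}
    (hr : (P n).eval r = 0) : r.re ∈ Set.Icc (-R) R := by
  obtain ⟨q, hq⟩ := dvd_iff_isRoot.2 hr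
  have hq0 : q ≠ 0 := by rintro rfl; simp [hP.ne_zero] at hq
  have h0 := hP.map_mul_eq_zero (n := n) (q := conjPoly q)
    (by rw [degree_conjPoly]; exact hP.degree_lt_of_factor (by simp) hq)
  rw [hq, mul_assoc, hint, ← hP.root_eq_re hu hr] at h0
  have hpos := (hu.mul_conj hq0).1
  rw [hint] at hpos
  simp only [eval_mul_conjPoly] at hpos
  rw [integral_complex_ofReal, Complex.ofReal_re] at hpos
  set w : ℝ → ℝ := fun x => ‖q.eval (x : ℂ)‖ ^ 2 with hw
  have hwc : Continuous w := by
    have := q.continuous.comp Complex.continuous_ofReal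
    exact this.norm.pow 2
  have e : ∀ x : ℝ, ((X - C ((r.re : ℝ) : ℂ)) * (q * conjPoly q)).eval (x : ℂ) =
      (((x - r.re) * w x : ℝ) : ℂ) := by
    intro x
    rw [eval_mul, eval_mul_conjPoly]
    simp [hw]
  simp only [e] at h0
  rw [integral_complex_ofReal, Complex.ofReal_eq_zero] at h0
  have aux : ∀ s : ℝ, ∀ c > 0, (∀ x ∈ Set.Icc (-R) R, c ≤ s * (x - r.re)) → False := by
    intro s c hc hs
    have h1 : ∫ x, c * w x ∂ν ≤ ∫ x, s * ((x - r.re) * w x) ∂ν := by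
      refine integral_mono_ae (integrable_of_ae_mem_Icc hR (by fun_prop))
        (integrable_of_ae_mem_Icc hR (by fun_prop)) ?_
      filter_upwards [hR] with x hx
      rw [← mul_assoc]
      exact mul_le_mul_of_nonneg_right (hs x hx) (sq_nonneg _)
    rw [integral_const_mul, integral_const_mul, h0, mul_zero] at h1
    exact absurd h1 (not_le.2 (mul_pos hc hpos))
  constructor
  · by_contra! h
    exact aux 1 (-R - r.re) (by linarith) fun x hx => by linarith [hx.1]
  · by_contra! h
    exact aux (-1) (r.re - R) (by linarith) fun x hx => by linarith [hx.2]

lemma exists_ball_zero_free {z : ℂ} (hz : z ∉ accZeros P ∪ recZeros P) :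
    ∃ δ > 0, ∃ N : ℕ, ∀ n ≥ N, ∀ w ∈ Metric.ball z δ, (P n).eval w ≠ 0 := by
  simp only [Set.mem_union, not_or] at hz
  obtain ⟨h1, h2⟩ := hz
  rw [accZeros, mem_derivedSet, accPt_iff_nhds] at h1
  push Not at h1
  obtain ⟨U, hU, h1⟩ := h1
  obtain ⟨δ, hδ, hball⟩ := Metric.mem_nhds_iff.1 hU
  have hfin : ∃ N : ℕ, ∀ n ≥ N, 1 ≤ n → (P n).eval z ≠ 0 := by
    by_cases hzZ : z ∈ zeroSet P
    · have : {n : ℕ | (P n).eval z = 0}.Finite := by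
        by_contra h
        exact h2 ⟨hzZ, h⟩
      obtain ⟨N, hN⟩ := this.bddAbove
      exact ⟨N + 1, fun n hn _ h => absurd (hN h) (by omega)⟩
    · exact ⟨0, fun n _ hn h => hzZ ⟨n, hn, h⟩⟩
  obtain ⟨N, hN⟩ := hfin
  refine ⟨δ, hδ, N + 1, fun n hn w hw h => ?_⟩
  -- The centre is the only point of the disc that can be a zero of any `P n` with `n ≥ 1`, and it
  -- is one for finitely many `n` only.
  have hwz := h1 w ⟨hball hw, n, by omega, h⟩
  rw [hwz] at h
  exact hN n (by omega) (by omega) h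

lemma ae_gaussMeasure {n : ℕ} {p : ℝ → Prop} (h : ∀ r ∈ zeros P n, p r.re) :
    ∀ᵐ x ∂(gaussMeasure u P n), p x := by
  rw [ae_iff, gaussMeasure, Measure.finsetSum_apply]
  refine Finset.sum_eq_zero fun r hr => ?_
  simp [h r hr]

/-- Near a real point of the disc the step functions are eventually constant, hence so is their
limit `ψ`. -/
lemma IsNaturalRepresentative.ae_le_norm_sub (hu : IsPosDef u) (hP : IsMonicOPS u P)
    (hψ : IsNaturalRepresentative u P ψ) (hmono : Monotone ψ) {z : ℂ} {δ : ℝ} {N : ℕ}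
    (hN : ∀ n ≥ N, ∀ w ∈ Metric.ball z δ, (P n).eval w ≠ 0) :
    ∀ᵐ x : ℝ ∂hmono.stieltjesFunction.measure, δ ≤ ‖z - x‖ := by
  obtain ⟨φ, hφ, hlim⟩ := hψ
  rw [ae_iff]
  refine measure_null_of_locally_null _ fun x hx => ?_
  simp only [Set.mem_ofPred_eq, not_le] at hx
  set η := (δ - ‖z - x‖) / 2 with hη
  have hη0 : 0 < η := by rw [hη]; linarith
  refine ⟨_, mem_nhdsWithin_of_mem_nhds (Ioc_half_mem_nhds hη0),
    stieltjes_Ioc_eq_zero hmono hη0 ?_⟩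
  refine le_of_tendsto ((hlim (x + η)).sub (hlim (x - η))) ?_
  filter_upwards [hφ.tendsto_atTop.eventually_ge_atTop N] with j hj
  rw [← hP.gaussMeasure_Ioc hu (φ j) (by linarith), measureReal_def,
    measure_eq_zero_iff_ae_notMem.2, ENNReal.toReal_zero]
  refine ae_gaussMeasure fun r hr hmem => ?_
  have hr := hP.mem_zeros.1 hr
  refine hN _ hj r ?_ hr
  rw [Metric.mem_ball, dist_comm, dist_eq_norm]
  have h1 : ‖(x : ℂ) - r‖ ≤ η := by
    rw [← hP.root_eq_re hu hr, ← Complex.ofReal_sub, Complex.norm_real, Real.norm_eq_abs, _root_.abs_le]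
    constructor <;> linarith [hmem.1, hmem.2]
  have h2 := norm_add_le (z - x) (x - r)
  rw [sub_add_sub_cancel] at h2
  linarith

/-! ### Approximation of the Cauchy kernel and the main estimate -/

lemma exists_polynomial_near_complex (a b : ℝ) {f : ℝ → ℂ} (hf : Continuous f) {ε : ℝ}
    (hε : 0 < ε) : ∃ p : ℂ[X], ∀ x ∈ Set.Icc a b, ‖f x - p.eval (x : ℂ)‖ < ε := by
  obtain ⟨p, hp⟩ := exists_polynomial_near_of_continuousOn a b (fun x => (f x).re)
    (by fun_prop) (ε / 2) (by linarith)
  obtain ⟨q, hq⟩ := exists_polynomial_near_of_continuousOn a b (fun x => (f x).im)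
    (by fun_prop) (ε / 2) (by linarith)
  refine ⟨p.map Complex.ofRealHom + C Complex.I * q.map Complex.ofRealHom, fun x hx => ?_⟩
  have e : ∀ s : ℝ[X], (s.map Complex.ofRealHom).eval (x : ℂ) = ((s.eval x : ℝ) : ℂ) :=
    fun s => eval_map_apply (p := s) Complex.ofRealHom x
  have h1 : f x - (p.map Complex.ofRealHom + C Complex.I * q.map Complex.ofRealHom).eval (x : ℂ) =
      (((f x).re - p.eval x : ℝ) : ℂ) + (((f x).im - q.eval x : ℝ) : ℂ) * Complex.I := by
    rw [eval_add, eval_mul, eval_C, e, e]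
    conv_lhs => rw [← Complex.re_add_im (f x)]
    push_cast
    ring
  rw [h1]
  refine (norm_add_le _ _).trans_lt ?_
  rw [norm_mul, Complex.norm_I, mul_one, Complex.norm_real, Complex.norm_real, Real.norm_eq_abs,
    Real.norm_eq_abs, abs_sub_comm, abs_sub_comm (f x).im]
  linarith [hp x hx, hq x hx]

/-- The Cauchy kernel is uniformly close to a polynomial away from its pole. -/
lemma exists_polynomial_near_cauchy (z : ℂ) (R : ℝ) {δ ε : ℝ} (hδ : 0 < δ) (hε : 0 < ε) :
    ∃ p : ℂ[X], ∀ x ∈ Set.Icc (-R) R, δ ≤ ‖z - x‖ → ‖1 / (z - x) - p.eval (x : ℂ)‖ < ε := by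
  have hm : ∀ x : ℝ, ((max ‖z - x‖ δ : ℝ) : ℂ) ^ 2 ≠ 0 := fun x => by
    have : 0 < max ‖z - x‖ δ := lt_max_of_lt_right hδ
    exact pow_ne_zero _ (Complex.ofReal_ne_zero.2 this.ne')
  -- A continuous function on the whole line that equals `1 / (z - x)` wherever `δ ≤ ‖z - x‖`, so
  -- that Weierstrass applies even when the pole is real.
  have hc : Continuous fun x : ℝ => starRingEnd ℂ (z - x) / ((max ‖z - x‖ δ : ℝ) : ℂ) ^ 2 :=
    Continuous.div (Complex.continuous_conj.comp (by fun_prop)) (by fun_prop) hm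
  obtain ⟨p, hp⟩ := exists_polynomial_near_complex (-R) R hc hε
  refine ⟨p, fun x hx hxz => ?_⟩
  have h0 : z - x ≠ 0 := norm_pos_iff.1 (hδ.trans_le hxz)
  have := hp x hx
  rwa [max_eq_left hxz, ← Complex.mul_conj', div_mul_cancel_right₀
    ((_root_.map_ne_zero _).2 h0), ← one_div] at this

lemma norm_one_div_sub_one_div_le {z w x : ℂ} {δ : ℝ} (hδ : 0 < δ) (hx : δ ≤ ‖z - x‖)
    (hw : ‖z - w‖ ≤ δ / 2) : ‖1 / (w - x) - 1 / (z - x)‖ ≤ ‖z - w‖ * (2 / δ ^ 2) := by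
  have h1 : δ / 2 ≤ ‖w - x‖ := by
    have := norm_add_le (z - w) (w - x)
    rw [sub_add_sub_cancel] at this
    linarith
  have hz0 : z - x ≠ 0 := norm_pos_iff.1 (by linarith)
  have hw0 : w - x ≠ 0 := norm_pos_iff.1 (by linarith)
  have e : 1 / (w - x) - 1 / (z - x) = (z - w) / ((w - x) * (z - x)) := by
    field_simp
    ring
  rw [e, norm_div, norm_mul, show ‖z - w‖ * (2 / δ ^ 2) = ‖z - w‖ / (δ / 2 * δ) by field_simp]
  gcongr

lemma integrable_cauchy {ν : Measure ℝ} [IsFiniteMeasure ν] {z : ℂ} {δ : ℝ} (hδ : 0 < δ)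
    (h : ∀ᵐ x : ℝ ∂ν, δ ≤ ‖z - x‖) : Integrable (fun x : ℝ => 1 / (z - (x : ℂ))) ν := by
  refine Integrable.of_bound (C := 1 / δ) (Measurable.aestronglyMeasurable (by fun_prop)) ?_
  filter_upwards [h] with x hx
  rw [norm_div, norm_one]
  exact one_div_le_one_div_of_le hδ hx

/-- One polynomial, chosen for the centre `z`, serves all nearby `w`; this gives local uniformity.
The kernel at `w` is within `2 * κ` of it (`κ` for moving the pole, `κ` for Weierstrass), so the two
transforms differ by at most `4 * κ * m`, which is `4 * ε / 5`. -/
lemma IsMonicOPS.exists_ball_dist_lt (hu : IsPosDef u) (hP : IsMonicOPS u P) {ν : Measure ℝ}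
    [IsFiniteMeasure ν] {R : ℝ} (hR : ∀ᵐ x ∂ν, x ∈ Set.Icc (-R) R)
    (hint : ∀ p : ℂ[X], u p = ∫ x : ℝ, p.eval (x : ℂ) ∂ν) {z : ℂ} {δ : ℝ} {N : ℕ} (hδ : 0 < δ)
    (hN : ∀ n ≥ N, ∀ w ∈ Metric.ball z δ, (P n).eval w ≠ 0)
    (hν : ∀ᵐ x : ℝ ∂ν, δ ≤ ‖z - x‖) {ε : ℝ} (hε : 0 < ε) :
    ∃ η > 0, ∀ᶠ n : ℕ in atTop, ∀ w ∈ Metric.ball z η, (P (n + 1)).eval w ≠ 0 ∧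
      dist (∫ x : ℝ, 1 / (w - (x : ℂ)) ∂ν)
        (u 1 * (associated u P 1 n).eval w / (P (n + 1)).eval w) < ε := by
  have hm0 := hu.one_re_pos
  have hmass : ν.real Set.univ = (u 1).re := by
    rw [hint 1]; simp
  set m := (u 1).re
  set κ := ε / (5 * m) with hκ
  have hκ0 : 0 < κ := by positivity
  obtain ⟨p, hp⟩ := exists_polynomial_near_cauchy z R hδ hκ0
  refine ⟨min (δ / 2) (κ / (2 / δ ^ 2)), by positivity, ?_⟩
  filter_upwards [eventually_ge_atTop N, eventually_ge_atTop p.natDegree] with n hn hnp w hw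
  rw [Metric.mem_ball, dist_comm, dist_eq_norm, lt_min_iff,
    lt_div_iff₀ (a := ‖z - w‖) (c := 2 / δ ^ 2) (by positivity)] at hw
  have hwz : w ∈ Metric.ball z δ := by
    rw [Metric.mem_ball, dist_comm, dist_eq_norm]; linarith [hw.1]
  have hne := hN (n + 1) (by omega) w hwz
  refine ⟨hne, ?_⟩
  have hclose : ∀ x : ℝ, x ∈ Set.Icc (-R) R → δ ≤ ‖z - x‖ →
      ‖1 / (w - (x : ℂ)) - p.eval (x : ℂ)‖ ≤ 2 * κ := by
    intro x hx hxz
    have h1 := norm_one_div_sub_one_div_le hδ hxz hw.1.le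
    have h2 := hp x hx hxz
    have h3 := norm_add_le (1 / (w - (x : ℂ)) - 1 / (z - x)) (1 / (z - x) - p.eval (x : ℂ))
    rw [sub_add_sub_cancel] at h3
    linarith [hw.2]
  have hgauss : ∀ r ∈ zeros P (n + 1), ‖1 / (w - (r.re : ℂ)) - p.eval (r.re : ℂ)‖ ≤ 2 * κ := by
    intro r hr
    have hr := hP.mem_zeros.1 hr
    refine hclose _ (hP.root_mem_Icc hu hR hint hr) ?_
    rw [hP.root_eq_re hu hr]
    by_contra! h
    refine hN (n + 1) (by omega) r ?_ hr
    rwa [Metric.mem_ball, dist_comm, dist_eq_norm]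
  have hpdeg : p.degree < (2 * (n + 1) : ℕ) :=
    degree_le_natDegree.trans_lt (by exact_mod_cast (by omega))
  have hwν : ∀ᵐ x : ℝ ∂ν, δ / 2 ≤ ‖w - x‖ := by
    filter_upwards [hν] with x hx
    have := norm_add_le (z - w) (w - (x : ℂ))
    rw [sub_add_sub_cancel] at this
    linarith [hw.1]
  have b1 : ‖∫ x : ℝ, (1 / (w - (x : ℂ)) - p.eval (x : ℂ)) ∂ν‖ ≤ 2 * κ * m := by
    rw [← hmass]
    refine norm_integral_le_of_norm_le_const ?_
    filter_upwards [hR, hν] with x h1 h2 using hclose x h1 h2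
  have b2 : ‖∫ x : ℝ, (1 / (w - (x : ℂ)) - p.eval (x : ℂ)) ∂(gaussMeasure u P (n + 1))‖ ≤
      2 * κ * m := by
    rw [show m = _ from (hP.gaussMeasure_univ hu (Nat.succ_pos n)).symm]
    exact norm_integral_le_of_norm_le_const (ae_gaussMeasure hgauss)
  rw [integral_sub (integrable_cauchy (by positivity) hwν)
    (integrable_of_ae_mem_Icc (f := fun x : ℝ => p.eval (x : ℂ)) hR
      (p.continuous.comp Complex.continuous_ofReal)), ← hint] at b1
  rw [integral_sub (integrable_gaussMeasure _ _) (integrable_gaussMeasure _ _),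
    ← hP.integral_gaussMeasure_eval hu (n + 1) hpdeg] at b2
  have e : u 1 * (associated u P 1 n).eval w / (P (n + 1)).eval w =
      ∫ x : ℝ, 1 / (w - (x : ℂ)) ∂(gaussMeasure u P (n + 1)) := by
    rw [hP.quotient_eq hu n hne, hP.integral_gaussMeasure hu]
    simp
  rw [e, dist_eq_norm]
  have h5 := norm_sub_le ((∫ x : ℝ, 1 / (w - (x : ℂ)) ∂ν) - u p)
    ((∫ x : ℝ, 1 / (w - (x : ℂ)) ∂(gaussMeasure u P (n + 1))) - u p)
  rw [sub_sub_sub_cancel_right] at h5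
  have h6 : κ * m = ε / 5 := by rw [hκ]; field_simp
  linarith

end OPS

/-- Markov's theorem. The quotient `u₀ P⁽¹⁾_{n-1} / P_n`, `n ≥ 1`, is written with `n + 1` in place
of `n`, and `dψ` is the Lebesgue–Stieltjes measure of the nondecreasing function `ψ`. -/
theorem mainTheorem8 (u : ℂ[X] →ₗ[ℂ] ℂ) (hu : OPS.IsPosDef u)
    (P : ℕ → ℂ[X]) (hP : OPS.IsMonicOPS u P)
    (ψ : ℝ → ℝ) (hψ : OPS.IsNaturalRepresentative u P ψ)
    (hσ : Bornology.IsBounded (OPS.spectrum ψ)) :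
    ∃ hmono : Monotone ψ,
      (∀ z : ℂ, z ∉ OPS.accZeros P ∪ OPS.recZeros P →
        Integrable (fun x : ℝ => 1 / (z - (x : ℂ))) hmono.stieltjesFunction.measure ∧
        Tendsto
          (fun n : ℕ => u 1 * (OPS.associated u P 1 n).eval z / (P (n + 1)).eval z)
          atTop (𝓝 (∫ x : ℝ, 1 / (z - (x : ℂ)) ∂hmono.stieltjesFunction.measure))) ∧
      (∀ K : Set ℂ, IsCompact K → K ⊆ (OPS.accZeros P ∪ OPS.recZeros P)ᶜ →
        (∀ᶠ n : ℕ in atTop, ∀ z ∈ K, (P (n + 1)).eval z ≠ 0) ∧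
        TendstoUniformlyOn
          (fun (n : ℕ) (z : ℂ) =>
            u 1 * (OPS.associated u P 1 n).eval z / (P (n + 1)).eval z)
          (fun z : ℂ => ∫ x : ℝ, 1 / (z - (x : ℂ)) ∂hmono.stieltjesFunction.measure)
          atTop K) := by
  have hmono := hψ.monotone hu hP
  have hfin := OPS.isFiniteMeasure_stieltjes hmono (hψ.abs_le hu hP)
  obtain ⟨R, -, hR⟩ := OPS.exists_ae_mem_Icc hmono hσ
  have hint := OPS.map_eq_integral hR (hψ.u_X_pow hu hP hmono hR)
  have key : ∀ z : ℂ, z ∉ OPS.accZeros P ∪ OPS.recZeros P → ∀ ε > 0,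
      ∃ η > 0, ∀ᶠ n : ℕ in atTop, ∀ w ∈ Metric.ball z η, (P (n + 1)).eval w ≠ 0 ∧
        dist (∫ x : ℝ, 1 / (w - (x : ℂ)) ∂hmono.stieltjesFunction.measure)
          (u 1 * (OPS.associated u P 1 n).eval w / (P (n + 1)).eval w) < ε := by
    intro z hz ε hε
    obtain ⟨δ, hδ, N, hN⟩ := OPS.exists_ball_zero_free hz
    exact hP.exists_ball_dist_lt hu hR hint hδ hN (hψ.ae_le_norm_sub hu hP hmono hN) hε
  refine ⟨hmono, fun z hz => ⟨?_, ?_⟩, fun K hK hKsub => ⟨?_, ?_⟩⟩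
  · obtain ⟨δ, hδ, N, hN⟩ := OPS.exists_ball_zero_free hz
    exact OPS.integrable_cauchy hδ (hψ.ae_le_norm_sub hu hP hmono hN)
  · rw [Metric.tendsto_nhds]
    intro ε hε
    obtain ⟨η, hη, h⟩ := key z hz ε hε
    filter_upwards [h] with n hn
    rw [dist_comm]
    exact (hn z (Metric.mem_ball_self hη)).2
  · refine hK.induction_on (p := fun s => ∀ᶠ n : ℕ in atTop, ∀ z ∈ s, (P (n + 1)).eval z ≠ 0)
      (by simp) (fun s t hst h => h.mono fun n hn z hz => hn z (hst hz)) ?_ ?_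
    · intro s t hs ht
      filter_upwards [hs, ht] with n h1 h2 z hz
      exact hz.elim (h1 z) (h2 z)
    · intro z hz
      obtain ⟨η, hη, h⟩ := key z (hKsub hz) 1 one_pos
      exact ⟨_, mem_nhdsWithin_of_mem_nhds (Metric.ball_mem_nhds z hη),
        h.mono fun n hn w hw => (hn w hw).1⟩
  · rw [← tendstoLocallyUniformlyOn_iff_tendstoUniformlyOn_of_compact hK,
      Metric.tendstoLocallyUniformlyOn_iff]
    intro ε hε z hz
    obtain ⟨η, hη, h⟩ := key z (hKsub hz) ε hε
    exact ⟨_, mem_nhdsWithin_of_mem_nhds (Metric.ball_mem_nhds z hη),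
      h.mono fun n hn w hw => (hn w hw).2⟩
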